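/- Let $p$ be a prime. For a positive integer $a$ put $A_a=\begin{pmatrix}0&1\\1&a\end{pmatrix}$, and for a finite word $u=a_1\ldots a_n$ of positive integers put $A_u=A_{a_1}\cdots A_{a_n}$. For $N\in\mathbb N$ let $\mathbb A_N=\{1,\dots,N\}$. On pairs $(w,\mathbf q)$ consisting of an infinite word $w=a_1a_2\ldots$ of positive integers and a point $\mathbf q$ of the projective line $\mathbf P^1_{\mathbb Q_p}$, define $\mathrm T(w,\mathbf q)=(a_2a_3\ldots,\,A_{a_1}\mathbf q)$. For $\epsilon>0$ let $\mathbf{PBad}_\epsilon$ be the set of $\mathbf q=(q_1,q_2)\in\mathbf P^1_{\mathbb Q_p}$ such that $$\frac{|aq_1+bq_2|_p}{\max\{|q_1|_p,|q_2|_p\}}\ \ge\ \frac{\epsilon}{\max\{|a|,|b|\}^{2}}\qquad\text{for all }(a,b)\in\mathbb Z^2\setminus\{(0,0)\}.$$ Let $\mathbf{LMad}$ be the set of pairs $(w,\mathbf x_p)$ for which there is $\epsilon>0$ such that $\mathrm T^n(w,\mathbf x_p)\in\mathbb A_{N_\epsilon}^{\mathbb N}\times\mathbf{PBad}_\epsilon$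 for all $n\ge 0$, where $N_\epsilon=\lfloor\epsilon^{-1}\rfloor+1$. Let $N\in\mathbb N$, let $w=a_1a_2\ldots\in\mathbb A_N^{\mathbb N}$ be a (purely) periodic infinite word, let $l\ge 1$ be the length of its minimal period, and let $w_l=a_1\ldots a_l$. Then for every $\mathbf x_p\in\mathbf P^1_{\mathbb Q_p}$, $(w,\mathbf x_p)\in\mathbf{LMad}$ if and only if $\mathbf x_p$ is (the class of) an eigenvector of $A_{w_l}^T$ in $\mathbb Q_p^2$. Moreover, the set $\mathbf{LMad}$ is infinite. -/

import Mathlib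

open scoped LinearAlgebra.Projectivization

noncomputable section

namespace PLC

/-- The projective line over the field of `p`-adic numbers. -/
abbrev P1 (p : ℕ) [Fact p.Prime] : Type := ℙ ℚ_[p] (Fin 2 → ℚ_[p])

/-- The matrix `A_a` attached to a letter `a`. -/
def letterMatrix (a : ℕ) : Matrix (Fin 2) (Fin 2) ℤ := !![0, 1; 1, (a : ℤ)]

theorem det_letterMatrix (a : ℕ) : (letterMatrix a).det = -1 := by
  simp [letterMatrix, Matrix.det_fin_two]

/-- The matrix `A_u = A_{a_1} ⋯ A_{a_l}` of a finite word `u = a_1 … a_l`. -/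
def wordMatrix (u : List ℕ) : Matrix (Fin 2) (Fin 2) ℤ := (u.map letterMatrix).prod

/-- The prefix of length `l` of an infinite word (the first letter of `w` is `w 0`). -/
def wordPrefix (w : ℕ → ℕ) (l : ℕ) : List ℕ := (List.range l).map w

/-- The infinite words over the alphabet `{1, …, N}`. -/
def words (N : ℕ) : Set (ℕ → ℕ) := {w | ∀ n, w n ∈ Set.Icc 1 N}

/-- An integer matrix, as a linear endomorphism of the plane of `p`-adic column vectors. -/
def padicLin (p : ℕ) [Fact p.Prime] (M : Matrix (Fin 2) (Fin 2) ℤ) :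
    (Fin 2 → ℚ_[p]) →ₗ[ℚ_[p]] (Fin 2 → ℚ_[p]) :=
  Matrix.toLin' (M.map (Int.castRingHom ℚ_[p]))

theorem padicLin_letterMatrix_injective (p : ℕ) [Fact p.Prime] (a : ℕ) :
    Function.Injective (padicLin p (letterMatrix a)) := by
  have h : IsUnit ((letterMatrix a).map (Int.castRingHom ℚ_[p])) := by
    rw [Matrix.isUnit_iff_isUnit_det, ← RingHom.mapMatrix_apply, ← RingHom.map_det,
      det_letterMatrix]
    simp
  intro x y hxy
  exact Matrix.mulVec_injective_of_isUnit h (by simpa [padicLin] using hxy)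

/-- The extended shift `T (w, q) = (T w, A_{a_1} q)`, where `a_1` is the first letter of `w`. -/
def T (p : ℕ) [Fact p.Prime] (x : (ℕ → ℕ) × P1 p) : (ℕ → ℕ) × P1 p :=
  (fun n => x.1 (n + 1),
    Projectivization.map (padicLin p (letterMatrix (x.1 0)))
      (padicLin_letterMatrix_injective p (x.1 0)) x.2)

/-- The points of the projective line which are `p`-adically badly approximable with constant `ε`.
The condition does not depend on the homogeneous coordinates `q = (q_1, q_2)`. With `0⁻¹ = ∞`,
`min {|a|⁻², |b|⁻²} = 1 / max {|a|, |b|} ^ 2` and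
`min {|q_1⁻¹|_p, |q_2⁻¹|_p} = 1 / max {|q_1|_p, |q_2|_p}`; both maxima are positive here. -/
def PBadEps (p : ℕ) [Fact p.Prime] (ε : ℝ) : Set (P1 p) :=
  {x | ∀ (q : Fin 2 → ℚ_[p]) (hq : q ≠ 0), Projectivization.mk ℚ_[p] q hq = x →
    ∀ a b : ℤ, (a, b) ≠ (0, 0) →
      ε / (max |(a : ℝ)| |(b : ℝ)|) ^ 2 ≤
        ‖(a : ℚ_[p]) * q 0 + (b : ℚ_[p]) * q 1‖ / max ‖q 0‖ ‖q 1‖}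

/-- The pairs all of whose images under the iterates of `T` lie in
`{1, …, N}^ℕ × PBad_ε`, with `N = [1/ε] + 1` (meant for `ε > 0`). -/
def LMadEps (p : ℕ) [Fact p.Prime] (ε : ℝ) : Set ((ℕ → ℕ) × P1 p) :=
  {x | ∀ n : ℕ, (T p)^[n] x ∈ words (⌊ε⁻¹⌋₊ + 1) ×ˢ PBadEps p ε}

/-- The set `LMad`: the union of the sets `LMad_ε` over all `ε > 0`. -/
def LMad (p : ℕ) [Fact p.Prime] : Set ((ℕ → ℕ) × P1 p) :=
  {x | ∃ ε : ℝ, 0 < ε ∧ x ∈ LMadEps p ε}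

/-- The point `x` of the projective line is (the class of) an eigenvector of `M`. -/
def IsEigenpoint (p : ℕ) [Fact p.Prime] (M : Matrix (Fin 2) (Fin 2) ℤ) (x : P1 p) : Prop :=
  ∃ (μ : ℚ_[p]) (v : Fin 2 → ℚ_[p]) (hv : Module.End.HasEigenvector (padicLin p M) μ v),
    x = Projectivization.mk ℚ_[p] v hv.2

end PLC

end

/-!
For a word of period `l` put `M = (A_{w_l})ᵀ`, a matrix in `GL₂(ℤ)`; then `T^l` acts on the second
component as `M`, and `M` preserves the maximum norm on `ℚ_p²`.

If `q` is not an eigenvector of `M`, write some power of `M` as `1 + p² B`. As `B q` is not a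
multiple of `q`, there is a linear form `φ` with integer coefficients such that
`|φ (q)| ≤ |p² φ (B q)|` and `φ (B q) ≠ 0`. In the binomial expansion of `φ ((1 + p² B)^n q)` the
linear term `n p² φ (B q)` dominates, so that up to scaling this sequence is an isometric embedding
of `ℕ` with the `p`-adic metric. A pigeonhole argument modulo `p^k` makes its image dense, in
particular `φ (M^n q)` comes arbitrarily close to `0` while `|M^n q| = |q|`, and no `PBad_ε`
contains the whole orbit.

If `M q = μ q`, let `D` be the determinant of the matrix with rows `v = (a, b)` and `v M`. It sends
`q` to `(v q, μ v q)`, hence `|D|_p |q|_p ≤ |v q|_p`. Now `D` is an integral quadratic form in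
`(a, b)` whose discriminant `tr(M)² - 4 det(M)` is not a square; therefore `D ≠ 0`, and
`1 ≤ |D| |D|_p` with `|D| = O(max(|a|, |b|)²)` gives the bound defining `PBad_ε`.

Hensel's lemma provides eigenvectors for the constant words with letter `4 p k`.
-/

namespace PLC

open Filter Matrix Topology

variable {p : ℕ} [hp : Fact p.Prime]

section PadicIntegers

theorem one_le_abs_mul_norm_intCast {n : ℤ} (hn : n ≠ 0) : 1 ≤ |(n : ℝ)| * ‖(n : ℚ_[p])‖ := by
  have hp0 : (0 : ℝ) < p := mod_cast hp.out.pos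
  have hle : (p : ℝ) ^ padicValInt p n ≤ |(n : ℝ)| := by
    exact_mod_cast Int.le_of_dvd (abs_pos.2 hn) ((dvd_abs _ _).2 (padicValInt_dvd n))
  rw [Padic.norm_eq_zpow_neg_valuation (Int.cast_ne_zero.2 hn), Padic.valuation_intCast,
    _root_.zpow_neg, zpow_natCast, ← div_eq_mul_inv, one_le_div (by positivity)]
  exact hle

theorem norm_intCast_mul_le (n : ℤ) (x : ℚ_[p]) : ‖(n : ℚ_[p]) * x‖ ≤ ‖x‖ := by
  rw [norm_mul]
  exact mul_le_of_le_one_left (norm_nonneg x) (Padic.norm_int_le_one n)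

theorem norm_natCast_mul_le (n : ℕ) (x : ℚ_[p]) : ‖(n : ℚ_[p]) * x‖ ≤ ‖x‖ := by
  simpa only [Int.cast_natCast] using norm_intCast_mul_le (n : ℤ) x

theorem norm_choose_le (n : ℕ) {k : ℕ} (hk : k ≠ 0) :
    ‖(n.choose k : ℚ_[p])‖ ≤ k * ‖(n : ℚ_[p])‖ := by
  obtain ⟨k, rfl⟩ := Nat.exists_eq_succ_of_ne_zero hk
  rcases n with _ | n
  · simp
  have hk1 : 1 ≤ ((k + 1 : ℕ) : ℝ) * ‖((k + 1 : ℕ) : ℚ_[p])‖ := by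
    simpa only [Int.cast_natCast, Nat.abs_cast] using
      one_le_abs_mul_norm_intCast (p := p) (n := (k + 1 : ℕ)) (by positivity)
  have habs : ((n + 1 : ℕ) : ℚ_[p]) * n.choose k = (n + 1).choose (k + 1) * (k + 1 : ℕ) := by
    exact_mod_cast Nat.add_one_mul_choose_eq n k
  calc ‖((n + 1).choose (k + 1) : ℚ_[p])‖
      ≤ ((k + 1 : ℕ) * ‖((k + 1 : ℕ) : ℚ_[p])‖) * ‖((n + 1).choose (k + 1) : ℚ_[p])‖ :=
        le_mul_of_one_le_left (norm_nonneg _) hk1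
    _ = (k + 1 : ℕ) * ‖((n + 1 : ℕ) : ℚ_[p]) * n.choose k‖ := by rw [habs, norm_mul]; ring
    _ ≤ (k + 1 : ℕ) * ‖((n + 1 : ℕ) : ℚ_[p])‖ := by
        gcongr
        rw [mul_comm]
        exact norm_natCast_mul_le (n.choose k) _

theorem norm_choose_sub_choose_le (m n k : ℕ) :
    ‖(m.choose k : ℚ_[p]) - n.choose k‖ ≤ k * ‖(m : ℚ_[p]) - n‖ := by
  wlog hnm : n ≤ m generalizing m n
  · rw [norm_sub_rev, norm_sub_rev (m : ℚ_[p])]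
    exact this n m (le_of_not_ge hnm)
  obtain ⟨d, rfl⟩ := Nat.exists_eq_add_of_le' hnm
  have hvand : ((d + n).choose k : ℚ_[p]) - n.choose k =
      ∑ i ∈ Finset.range k, (d.choose (i + 1) : ℚ_[p]) * n.choose (k - (i + 1)) := by
    rw [Nat.add_choose_eq, Finset.Nat.sum_antidiagonal_eq_sum_range_succ_mk,
      Finset.sum_range_succ']
    simp
  rw [hvand, Nat.cast_add, add_sub_cancel_right]
  refine IsUltrametricDist.norm_sum_le_of_forall_le_of_nonneg (by positivity) fun i hi => ?_
  calc ‖(d.choose (i + 1) : ℚ_[p]) * n.choose (k - (i + 1))‖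
      ≤ ‖(d.choose (i + 1) : ℚ_[p])‖ := by
        rw [mul_comm]
        exact norm_natCast_mul_le (n.choose (k - (i + 1))) _
    _ ≤ (i + 1 : ℕ) * ‖(d : ℚ_[p])‖ := norm_choose_le d i.succ_ne_zero
    _ ≤ k * ‖(d : ℚ_[p])‖ := by
        gcongr
        exact Finset.mem_range.1 hi

-- An injective self-map of the finite ring `ZMod (p ^ k)` is onto, for every `k`.
theorem denseRange_of_norm_sub_le {f : ℕ → ℤ_[p]}
    (hf : ∀ m n : ℕ, ‖(m : ℤ_[p]) - n‖ ≤ ‖f m - f n‖) : DenseRange f := by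
  refine Metric.denseRange_iff.2 fun x r hr => ?_
  obtain ⟨k, hk⟩ := PadicInt.exists_pow_neg_lt p hr
  have : NeZero (p ^ k) := ⟨pow_ne_zero k hp.out.ne_zero⟩
  have hcongr : ∀ y z : ℤ_[p], ‖y - z‖ ≤ (p : ℝ) ^ (-k : ℤ) ↔
      PadicInt.toZModPow k y = PadicInt.toZModPow k z := fun y z => by
    rw [PadicInt.norm_le_pow_iff_mem_span_pow, ← PadicInt.ker_toZModPow, RingHom.mem_ker,
      map_sub, sub_eq_zero]
  have hinj : Function.Injective fun z : ZMod (p ^ k) => PadicInt.toZModPow k (f z.val) := by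
    intro y z hyz
    simpa using (hcongr _ _).1 ((hf _ _).trans ((hcongr _ _).2 hyz))
  obtain ⟨z, hz⟩ := Finite.injective_iff_surjective.1 hinj (PadicInt.toZModPow k x)
  exact ⟨z.val, (dist_eq_norm x _).trans_lt (((hcongr _ _).2 hz.symm).trans_lt hk)⟩

theorem exists_norm_lt_of_norm_sub_eq {f : ℕ → ℚ_[p]} {c : ℚ_[p]} (hc : c ≠ 0)
    (hf : ∀ m n : ℕ, ‖f m - f n‖ = ‖c‖ * ‖(m : ℚ_[p]) - n‖) (h0 : ‖f 0‖ ≤ ‖c‖)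
    {δ : ℝ} (hδ : 0 < δ) : ∃ n, ‖f n‖ < δ := by
  have hc' : 0 < ‖c‖ := norm_pos_iff.2 hc
  have hfc : ∀ n, ‖f n / c‖ ≤ 1 := fun n => by
    rw [norm_div, div_le_one hc', ← sub_add_cancel (f n) (f 0)]
    refine (Padic.nonarchimedean _ _).trans (max_le ?_ h0)
    rw [hf, Nat.cast_zero, sub_zero]
    exact mul_le_of_le_one_right hc'.le (mod_cast Padic.norm_int_le_one n)
  choose g hg using fun n => show ∃ z : ℤ_[p], (z : ℚ_[p]) = f n / c from ⟨⟨_, hfc n⟩, rfl⟩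
  have hdense : DenseRange g := by
    refine denseRange_of_norm_sub_le fun m n => ge_of_eq ?_
    rw [PadicInt.norm_def, PadicInt.norm_def, PadicInt.coe_sub, PadicInt.coe_sub,
      PadicInt.coe_natCast, PadicInt.coe_natCast, hg, hg, ← sub_div, norm_div, hf,
      mul_div_cancel_left₀ _ hc'.ne']
  obtain ⟨n, hn⟩ := hdense.exists_dist_lt 0 (div_pos hδ hc')
  refine ⟨n, ?_⟩
  rwa [dist_zero_left, PadicInt.norm_def, hg, norm_div, div_lt_div_iff_of_pos_right hc'] at hn

end PadicIntegers

section BinomialExpansion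

variable {R : Type*} [Ring R] (ψ : R →+ ℚ_[p]) {b : R}

theorem map_one_add_pow (n : ℕ) {N : ℕ} (hN : n ≤ N) :
    ψ ((1 + (p ^ 2 : ℕ) • b) ^ n) =
      ∑ k ∈ Finset.range (N + 1), (n.choose k : ℚ_[p]) * ((p : ℚ_[p]) ^ (2 * k) * ψ (b ^ k)) := by
  have hext : ∀ k ∈ Finset.range (N + 1), k ∉ Finset.range (n + 1) →
      (n.choose k : ℚ_[p]) * ((p : ℚ_[p]) ^ (2 * k) * ψ (b ^ k)) = 0 := fun k _ hk => by
    rw [Nat.choose_eq_zero_of_lt (by simpa using hk), Nat.cast_zero, zero_mul]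
  rw [add_comm, (Commute.one_right _).add_pow, map_sum,
    ← Finset.sum_subset (Finset.range_mono (by lia)) hext]
  refine Finset.sum_congr rfl fun k _ => ?_
  rw [one_pow, mul_one, smul_pow, ← Nat.cast_comm, ← nsmul_eq_mul, map_nsmul, map_nsmul,
    nsmul_eq_mul, nsmul_eq_mul, pow_mul]
  push_cast
  ring

theorem natCast_mul_inv_pow_lt {k : ℕ} (hk : 2 ≤ k) :
    (k : ℝ) * (p : ℝ)⁻¹ ^ (2 * k) < (p : ℝ)⁻¹ ^ 2 := by
  have hp1 : (1 : ℝ) ≤ p := mod_cast hp.out.one_le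
  have hlt : (k : ℝ) < p ^ k := mod_cast Nat.lt_pow_self hp.out.one_lt
  have hle : (p : ℝ) ^ k * p ^ 2 ≤ p ^ (2 * k) := by
    rw [← pow_add]
    exact pow_le_pow_right₀ hp1 (by lia)
  rw [inv_pow, inv_pow, ← div_eq_mul_inv, div_lt_iff₀ (by positivity),
    lt_inv_mul_iff₀ (by positivity), mul_comm]
  exact (mul_lt_mul_of_pos_right hlt (by positivity)).trans_le hle

-- `C(m, k) - C(n, k)` is `p`-adically at most `k |m - n|`, so in the binomial expansion the terms
-- with `k ≥ 2` are dominated by the linear one.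
theorem norm_map_one_add_pow_sub (hb : ∀ k, ‖ψ (b ^ k)‖ ≤ ‖ψ b‖) (hψ : ψ b ≠ 0) (m n : ℕ) :
    ‖ψ ((1 + (p ^ 2 : ℕ) • b) ^ m) - ψ ((1 + (p ^ 2 : ℕ) • b) ^ n)‖ =
      ‖(p : ℚ_[p]) ^ 2 * ψ b‖ * ‖(m : ℚ_[p]) - n‖ := by
  rcases eq_or_ne m n with rfl | hmn
  · simp
  set c : ℚ_[p] := (p : ℚ_[p]) ^ 2 * ψ b with hc
  let term : ℕ → ℚ_[p] := fun k =>
    ((m.choose k : ℚ_[p]) - n.choose k) * ((p : ℚ_[p]) ^ (2 * k) * ψ (b ^ k))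
  have hsum : ψ ((1 + (p ^ 2 : ℕ) • b) ^ m) - ψ ((1 + (p ^ 2 : ℕ) • b) ^ n) =
      c * (m - n) + ∑ k ∈ Finset.range (m + n), term (k + 2) := by
    rw [map_one_add_pow ψ m (N := m + n + 1) (by lia),
      map_one_add_pow ψ n (N := m + n + 1) (by lia), ← Finset.sum_sub_distrib,
      Finset.sum_range_succ', Finset.sum_range_succ']
    simp only [← sub_mul, term, hc, zero_add, Nat.choose_one_right, Nat.choose_zero_right,
      Nat.cast_one, sub_self, add_zero, mul_one, pow_one]
    ring
  have hterm : ∀ k, ‖term (k + 2)‖ < ‖c * (m - n)‖ := fun k => by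
    calc ‖term (k + 2)‖
        ≤ ((k + 2 : ℕ) * ‖(m : ℚ_[p]) - n‖) * ((p : ℝ)⁻¹ ^ (2 * (k + 2)) * ‖ψ b‖) := by
          rw [norm_mul, norm_mul, norm_pow, Padic.norm_p]
          gcongr
          exacts [norm_choose_sub_choose_le m n _, hb _]
      _ = ((k + 2 : ℕ) * (p : ℝ)⁻¹ ^ (2 * (k + 2))) * (‖ψ b‖ * ‖(m : ℚ_[p]) - n‖) := by ring
      _ < (p : ℝ)⁻¹ ^ 2 * (‖ψ b‖ * ‖(m : ℚ_[p]) - n‖) := by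
          refine mul_lt_mul_of_pos_right (natCast_mul_inv_pow_lt (by lia)) ?_
          rw [← norm_mul]
          refine norm_pos_iff.2 (mul_ne_zero hψ (sub_ne_zero.2 (Nat.cast_injective.ne hmn)))
      _ = ‖c * (m - n)‖ := by rw [norm_mul, hc, norm_mul, norm_pow, Padic.norm_p, mul_assoc]
  have htail : ‖∑ k ∈ Finset.range (m + n), term (k + 2)‖ < ‖c * (m - n)‖ := by
    obtain ⟨k, -, hk⟩ := IsUltrametricDist.exists_norm_finsetSum_le (Finset.range (m + n))
      fun k => term (k + 2)
    exact hk.trans_lt (hterm k)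
  rw [hsum, Padic.add_eq_max_of_ne htail.ne', max_eq_left htail.le, norm_mul]

theorem exists_norm_map_one_add_pow_lt (hb : ∀ k, ‖ψ (b ^ k)‖ ≤ ‖ψ b‖) (hψ : ψ b ≠ 0)
    (h1 : ‖ψ 1‖ ≤ ‖(p : ℚ_[p]) ^ 2 * ψ b‖) {δ : ℝ} (hδ : 0 < δ) :
    ∃ n, ‖ψ ((1 + (p ^ 2 : ℕ) • b) ^ n)‖ < δ :=
  exists_norm_lt_of_norm_sub_eq
    (mul_ne_zero (pow_ne_zero 2 (Nat.cast_ne_zero.2 hp.out.ne_zero)) hψ)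
    (norm_map_one_add_pow_sub ψ hb hψ) (by simpa only [pow_zero] using h1) hδ

end BinomialExpansion

section PadicPlane

theorem norm_eq_max {E : Type*} [SeminormedAddGroup E] (v : Fin 2 → E) :
    ‖v‖ = max ‖v 0‖ ‖v 1‖ := by
  refine le_antisymm ?_ (max_le (norm_le_pi_norm v 0) (norm_le_pi_norm v 1))
  rw [pi_norm_le_iff_of_nonneg (le_max_of_le_left (norm_nonneg _)), Fin.forall_fin_two]
  exact ⟨le_max_left _ _, le_max_right _ _⟩

variable (M M' : Matrix (Fin 2) (Fin 2) ℤ) (q : Fin 2 → ℚ_[p])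

variable (p) in
/-- The representation `M ↦ padicLin p M` of the ring of integer matrices on the plane over
`ℚ_[p]`. -/
noncomputable def padicLinHom : Matrix (Fin 2) (Fin 2) ℤ →+* Module.End ℚ_[p] (Fin 2 → ℚ_[p]) :=
  (Matrix.toLinAlgEquiv' : _ ≃ₐ[ℚ_[p]] _).toRingEquiv.toRingHom.comp
    (Int.castRingHom ℚ_[p]).mapMatrix

theorem padicLinHom_apply : padicLinHom p M = padicLin p M := rfl

theorem padicLin_apply (i : Fin 2) :
    padicLin p M q i = (M i 0 : ℚ_[p]) * q 0 + M i 1 * q 1 := by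
  simp [padicLin, Matrix.mulVec, dotProduct]

theorem padicLin_one : padicLin p 1 q = q := by
  rw [← padicLinHom_apply, map_one, Module.End.one_apply]

theorem padicLin_mul : padicLin p (M * M') q = padicLin p M (padicLin p M' q) := by
  rw [← padicLinHom_apply, map_mul, Module.End.mul_apply, padicLinHom_apply, padicLinHom_apply]

theorem padicLin_add : padicLin p (M + M') q = padicLin p M q + padicLin p M' q := by
  rw [← padicLinHom_apply, map_add, LinearMap.add_apply, padicLinHom_apply, padicLinHom_apply]

theorem padicLin_smul (n : ℤ) : padicLin p (n • M) q = (n : ℚ_[p]) • padicLin p M q := by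
  rw [← padicLinHom_apply, map_zsmul, LinearMap.smul_apply, padicLinHom_apply,
    Int.cast_smul_eq_zsmul]

theorem norm_padicLin_le : ‖padicLin p M q‖ ≤ ‖q‖ := by
  refine (pi_norm_le_iff_of_nonneg (norm_nonneg q)).2 fun i => ?_
  rw [padicLin_apply]
  exact (Padic.nonarchimedean _ _).trans <| max_le
    ((norm_intCast_mul_le _ _).trans (norm_le_pi_norm q 0))
    ((norm_intCast_mul_le _ _).trans (norm_le_pi_norm q 1))

theorem norm_det_mul_norm_le : ‖(M.det : ℚ_[p])‖ * ‖q‖ ≤ ‖padicLin p M q‖ := by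
  have hadj : padicLin p M.adjugate (padicLin p M q) = (M.det : ℚ_[p]) • q := by
    rw [← padicLin_mul, adjugate_mul, padicLin_smul, padicLin_one]
  rw [← norm_smul, ← hadj]
  exact norm_padicLin_le _ _

variable {M}

theorem norm_padicLin (hM : IsUnit M.det) : ‖padicLin p M q‖ = ‖q‖ := by
  refine (norm_padicLin_le M q).antisymm (le_of_eq_of_le ?_ (norm_det_mul_norm_le M q))
  rcases Int.isUnit_iff.1 hM with h | h <;> simp [h]

theorem padicLin_injective (hM : IsUnit M.det) : Function.Injective (padicLin p M) :=
  (injective_iff_map_eq_zero _).2 fun q hq => norm_eq_zero.1 <| by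
    rw [← norm_padicLin q hM, hq, norm_zero]

variable {q}

theorem isEigenpoint_mk_iff (hq : q ≠ 0) :
    IsEigenpoint p M (Projectivization.mk ℚ_[p] q hq) ↔ ∃ μ : ℚ_[p], padicLin p M q = μ • q := by
  constructor
  · rintro ⟨μ, v, hv, h⟩
    obtain ⟨a, rfl⟩ := (Projectivization.mk_eq_mk_iff' _ _ _ _ _).1 h
    exact ⟨μ, by rw [map_smul, hv.apply_eq_smul, smul_comm]⟩
  · rintro ⟨μ, h⟩
    exact ⟨μ, q, ⟨Module.End.mem_eigenspace_iff.2 h, hq⟩, rfl⟩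

end PadicPlane

section IntegralForms

variable (p) in
/-- The linear form `q ↦ a q₁ + b q₂` with integer coefficients on the plane over `ℚ_[p]`. -/
noncomputable def intForm (a b : ℤ) : (Fin 2 → ℚ_[p]) →ₗ[ℚ_[p]] ℚ_[p] :=
  (a : ℚ_[p]) • LinearMap.proj 0 + (b : ℚ_[p]) • LinearMap.proj 1

theorem intForm_apply (a b : ℤ) (q : Fin 2 → ℚ_[p]) :
    intForm p a b q = (a : ℚ_[p]) * q 0 + b * q 1 := rfl

theorem mk_mem_PBadEps_iff {ε : ℝ} {q : Fin 2 → ℚ_[p]} (hq : q ≠ 0) :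
    Projectivization.mk ℚ_[p] q hq ∈ PBadEps p ε ↔ ∀ a b : ℤ, (a, b) ≠ (0, 0) →
      ε / (max |(a : ℝ)| |(b : ℝ)|) ^ 2 * ‖q‖ ≤ ‖intForm p a b q‖ := by
  have hpos : ∀ {r : Fin 2 → ℚ_[p]}, r ≠ 0 → 0 < max ‖r 0‖ ‖r 1‖ := fun hr => by
    rw [← norm_eq_max]
    exact norm_pos_iff.2 hr
  constructor
  · intro h a b hab
    rw [norm_eq_max, ← le_div_iff₀ (hpos hq)]
    exact h q hq rfl a b hab
  · intro h r hr hrq a b hab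
    obtain ⟨c, rfl⟩ := (Projectivization.mk_eq_mk_iff' _ _ _ _ _).1 hrq
    rw [le_div_iff₀ (hpos hr), ← norm_eq_max, ← intForm_apply, map_smul, norm_smul, norm_smul,
      mul_left_comm]
    gcongr
    exact h a b hab

theorem exists_intCast_mem_of_isOpen {U : Set (Fin 2 → ℚ_[p])} (hU : IsOpen U)
    (hne : U.Nonempty) (hsmul : ∀ n : ℤ, n ≠ 0 → ∀ v ∈ U, (n : ℚ_[p]) • v ∈ U) :
    ∃ a b : ℤ, ![(a : ℚ_[p]), (b : ℚ_[p])] ∈ U := by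
  obtain ⟨r, hr⟩ := (DenseRange.piMap fun _ : Fin 2 => Padic.denseRange_ratCast p).exists_mem_open
    hU hne
  refine ⟨(r 0).num * (r 1).den, (r 1).num * (r 0).den, ?_⟩
  convert hsmul ((r 0).den * (r 1).den)
    (mul_ne_zero (mod_cast (r 0).den_ne_zero) (mod_cast (r 1).den_ne_zero)) _ hr using 1
  have hcast : ∀ i, ((r i : ℚ) : ℚ_[p]) * (r i).den = (r i).num := fun i => by
    exact_mod_cast congrArg ((↑) : ℚ → ℚ_[p]) (Rat.mul_den_eq_num (r i))
  refine funext (Fin.forall_fin_two.2 ⟨?_, ?_⟩)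
  · simp only [Int.cast_mul, ← hcast, Int.cast_natCast, cons_val_zero, Pi.smul_apply,
      Pi.map_apply, smul_eq_mul]
    ring
  · simp only [Int.cast_mul, ← hcast, Int.cast_natCast, cons_val_one, cons_val_fin_one,
      Pi.smul_apply, Pi.map_apply, smul_eq_mul]
    ring

theorem mul_sub_mul_ne_zero_of_forall_ne_smul {K : Type*} [Field K] {x y : Fin 2 → K} (hx : x ≠ 0)
    (hy : ∀ μ : K, y ≠ μ • x) : x 0 * y 1 - x 1 * y 0 ≠ 0 := by
  have hli : LinearIndependent K ![x, y] :=
    (LinearIndependent.pair_iff' hx).2 fun μ h => hy μ h.symm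
  have hdet := (Matrix.of ![x, y]).isUnit_iff_isUnit_det.1
    (Matrix.linearIndependent_rows_iff_isUnit.1 hli)
  simpa [det_fin_two] using hdet.ne_zero

-- The inequality is an open condition on `(a, b)`, and it holds at `(-q 1, q 0)`.
theorem exists_norm_intForm_lt {q y : Fin 2 → ℚ_[p]} (hq : q ≠ 0)
    (hy : ∀ μ : ℚ_[p], y ≠ μ • q) {δ : ℝ} (hδ : 0 < δ) :
    ∃ a b : ℤ, ‖intForm p a b q‖ < δ * ‖intForm p a b y‖ := by
  have hopen : IsOpen {v : Fin 2 → ℚ_[p] |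
      ‖v 0 * q 0 + v 1 * q 1‖ < δ * ‖v 0 * y 0 + v 1 * y 1‖} :=
    isOpen_lt (by fun_prop) (by fun_prop)
  refine exists_intCast_mem_of_isOpen hopen ⟨![-q 1, q 0], ?_⟩ fun n hn v hv => ?_
  · have hzero : -q 1 * q 0 + q 0 * q 1 = 0 := by ring
    have hdet : -q 1 * y 0 + q 0 * y 1 = q 0 * y 1 - q 1 * y 0 := by ring
    change ‖-q 1 * q 0 + q 0 * q 1‖ < δ * ‖-q 1 * y 0 + q 0 * y 1‖
    rw [hzero, hdet, norm_zero]
    exact mul_pos hδ (norm_pos_iff.2 (mul_sub_mul_ne_zero_of_forall_ne_smul hq hy))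
  · change ‖n * v 0 * q 0 + n * v 1 * q 1‖ < δ * ‖n * v 0 * y 0 + n * v 1 * y 1‖
    simp only [mul_assoc, ← mul_add, norm_mul _ (_ + _)]
    rw [mul_left_comm]
    exact mul_lt_mul_of_pos_left hv (norm_pos_iff.2 (Int.cast_ne_zero.2 hn))

end IntegralForms

section Growth

theorem exists_pow_eq_one_add_nsmul {n : Type*} [Fintype n] [DecidableEq n] {M : Matrix n n ℤ}
    (hM : IsUnit M.det) {k : ℕ} (hk : 0 < k) :
    ∃ m, 0 < m ∧ ∃ B : Matrix n n ℤ, M ^ m = 1 + k • B := by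
  have : NeZero k := ⟨hk.ne'⟩
  let f : Matrix n n ℤ →+* Matrix n n (ZMod k) := (Int.castRingHom (ZMod k)).mapMatrix
  obtain ⟨u, hu⟩ := ((isUnit_iff_isUnit_det M).2 hM).map f
  obtain ⟨m, hm, hum⟩ := (isOfFinOrder_of_finite u).exists_pow_eq_one
  have hMm : f (M ^ m) = f 1 := by
    rw [map_pow, map_one, ← hu, ← Units.val_pow_eq_pow_val, hum, Units.val_one]
  have hdvd : ∀ i j, (k : ℤ) ∣ (M ^ m - 1) i j := fun i j => by
    rw [← ZMod.intCast_zmod_eq_zero_iff_dvd, Matrix.sub_apply, Int.cast_sub, sub_eq_zero]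
    exact congrFun₂ hMm i j
  choose B hB using hdvd
  refine ⟨m, hm, of B, ?_⟩
  ext i j
  rw [Matrix.add_apply, Matrix.smul_apply, of_apply, nsmul_eq_mul, ← sub_eq_iff_eq_add',
    ← Matrix.sub_apply]
  exact hB i j

section CayleyHamilton

variable {R : Type*} [CommRing R] [Nontrivial R] (M : Matrix (Fin 2) (Fin 2) R)

theorem sq_eq_trace_smul_sub_det_smul_one : M ^ 2 = M.trace • M - M.det • 1 := by
  have h := aeval_self_charpoly M
  simp only [charpoly_fin_two, map_add, map_sub, map_mul, map_pow, Polynomial.aeval_X,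
    Polynomial.aeval_C, Algebra.algebraMap_eq_smul_one, smul_mul_assoc, one_mul] at h
  linear_combination (norm := module) h

theorem exists_pow_eq_smul_add_smul_one (n : ℕ) : ∃ u v : R, M ^ n = u • M + v • 1 := by
  induction n with
  | zero => exact ⟨0, 1, by simp⟩
  | succ n ih =>
    obtain ⟨u, v, h⟩ := ih
    refine ⟨u * M.trace + v, -(u * M.det), ?_⟩
    rw [pow_succ, h, add_mul, smul_mul_assoc, smul_mul_assoc, one_mul, ← pow_two,
      sq_eq_trace_smul_sub_det_smul_one]
    module

end CayleyHamilton

theorem norm_map_pow_le {B : Matrix (Fin 2) (Fin 2) ℤ} (ψ : Matrix (Fin 2) (Fin 2) ℤ →+ ℚ_[p])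
    (h1 : ‖ψ 1‖ ≤ ‖ψ B‖) (k : ℕ) : ‖ψ (B ^ k)‖ ≤ ‖ψ B‖ := by
  obtain ⟨u, v, h⟩ := exists_pow_eq_smul_add_smul_one B k
  rw [h, map_add, map_zsmul, map_zsmul, zsmul_eq_mul, zsmul_eq_mul]
  exact (Padic.nonarchimedean _ _).trans <| max_le (norm_intCast_mul_le _ _)
    ((norm_intCast_mul_le _ _).trans h1)

theorem padicLin_ne_smul_of_pow_eq {M B : Matrix (Fin 2) (Fin 2) ℤ} {m k : ℕ}
    (hpow : M ^ m ∉ Set.range (scalar (Fin 2))) (hB : M ^ m = 1 + k • B) {q : Fin 2 → ℚ_[p]}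
    (hMq : ∀ μ : ℚ_[p], padicLin p M q ≠ μ • q) (μ : ℚ_[p]) : padicLin p B q ≠ μ • q := by
  intro hμ
  obtain ⟨u, v, huv⟩ := exists_pow_eq_smul_add_smul_one M m
  have hu : (u : ℚ_[p]) ≠ 0 := Int.cast_ne_zero.2 <| by
    rintro rfl
    exact hpow ⟨v, by rw [huv, zero_smul, zero_add, smul_one_eq_diagonal, scalar_apply]⟩
  have hq : q + (k : ℚ_[p]) • μ • q = (u : ℚ_[p]) • padicLin p M q + (v : ℚ_[p]) • q := by
    simpa only [← natCast_zsmul, padicLin_add, padicLin_smul, padicLin_one, hμ,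
      Int.cast_natCast] using congrArg (padicLin p · q) (hB.symm.trans huv)
  refine hMq ((u : ℚ_[p])⁻¹ * (1 + k * μ - v)) ?_
  rw [mul_smul, eq_inv_smul_iff₀ hu]
  linear_combination (norm := module) -hq

theorem exists_intForm_padicLin_pow_lt {M : Matrix (Fin 2) (Fin 2) ℤ} (hM : IsUnit M.det)
    (hpow : ∀ m, 0 < m → M ^ m ∉ Set.range (scalar (Fin 2))) {q : Fin 2 → ℚ_[p]} (hq : q ≠ 0)
    (hMq : ∀ μ : ℚ_[p], padicLin p M q ≠ μ • q) :
    ∃ a b : ℤ, (a, b) ≠ (0, 0) ∧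
      ∀ δ > 0, ∃ k, ‖intForm p a b (padicLin p (M ^ k) q)‖ < δ := by
  obtain ⟨m, hm, B, hB⟩ := exists_pow_eq_one_add_nsmul hM (pow_pos hp.out.pos 2)
  have hp0 : (p : ℚ_[p]) ≠ 0 := Nat.cast_ne_zero.2 hp.out.ne_zero
  have hBq := padicLin_ne_smul_of_pow_eq (hpow m hm) hB hMq
  obtain ⟨a, b, hab⟩ := exists_norm_intForm_lt hq hBq (norm_pos_iff.2 (pow_ne_zero 2 hp0))
  rw [← norm_mul] at hab
  have hne : intForm p a b (padicLin p B q) ≠ 0 := by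
    intro h
    rw [h, mul_zero, norm_zero] at hab
    exact hab.not_ge (norm_nonneg _)
  let ψ : Matrix (Fin 2) (Fin 2) ℤ →+ ℚ_[p] := AddMonoidHom.mk'
    (fun X => intForm p a b (padicLin p X q)) fun X Y => by rw [padicLin_add, map_add]
  have hψ1 : ‖ψ 1‖ ≤ ‖(p : ℚ_[p]) ^ 2 * ψ B‖ := by
    simpa only [ψ, AddMonoidHom.mk'_apply, padicLin_one] using hab.le
  have hψB := norm_map_pow_le ψ <| hψ1.trans <| by
    rw [← Nat.cast_pow]
    exact norm_natCast_mul_le (p ^ 2) (ψ B)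
  refine ⟨a, b, ?_, fun δ hδ => ?_⟩
  · rintro ⟨⟩
    exact hne (by simp [intForm_apply])
  · obtain ⟨n, hn⟩ := exists_norm_map_one_add_pow_lt ψ hψB hne hψ1 hδ
    rw [← hB, ← pow_mul] at hn
    exact ⟨m * n, hn⟩

end Growth

section Anisotropy

/-- The matrix with rows `v` and `v M`, where `v = (a, b)`. Its determinant is the binary quadratic
form in `(a, b)` whose zeros are the left eigenvectors of `M`. -/
def krylovMatrix (M : Matrix (Fin 2) (Fin 2) ℤ) (a b : ℤ) : Matrix (Fin 2) (Fin 2) ℤ :=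
  of ![![a, b], ![a, b] ᵥ* M]

variable (M : Matrix (Fin 2) (Fin 2) ℤ)

theorem det_krylovMatrix (a b : ℤ) :
    (krylovMatrix M a b).det = M 0 1 * a ^ 2 + (M 1 1 - M 0 0) * (a * b) - M 1 0 * b ^ 2 := by
  simp only [krylovMatrix, det_fin_two, vecMul, dotProduct, of_apply, cons_val', cons_val_zero,
    cons_val_one, cons_val_fin_one, Fin.sum_univ_two]
  ring

theorem abs_det_krylovMatrix_le (a b : ℤ) :
    |((krylovMatrix M a b).det : ℝ)| ≤
      (|(M 0 1 : ℝ)| + |(M 1 1 : ℝ) - M 0 0| + |(M 1 0 : ℝ)|) *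
        (max |(a : ℝ)| |(b : ℝ)|) ^ 2 := by
  set m := max |(a : ℝ)| |(b : ℝ)|
  have ha : |(a : ℝ)| ≤ m := le_max_left _ _
  have hb : |(b : ℝ)| ≤ m := le_max_right _ _
  rw [det_krylovMatrix]
  push_cast
  calc |(M 0 1 : ℝ) * a ^ 2 + (M 1 1 - M 0 0) * (a * b) - M 1 0 * b ^ 2|
      ≤ |(M 0 1 : ℝ) * a ^ 2| + |((M 1 1 : ℝ) - M 0 0) * (a * b)| + |(M 1 0 : ℝ) * b ^ 2| :=
        (abs_sub _ _).trans (by gcongr; exact abs_add_le _ _)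
    _ = |(M 0 1 : ℝ)| * |(a : ℝ)| ^ 2 + |(M 1 1 : ℝ) - M 0 0| * (|(a : ℝ)| * |(b : ℝ)|) +
          |(M 1 0 : ℝ)| * |(b : ℝ)| ^ 2 := by simp only [abs_mul, abs_pow]
    _ ≤ |(M 0 1 : ℝ)| * m ^ 2 + |(M 1 1 : ℝ) - M 0 0| * (m * m) + |(M 1 0 : ℝ)| * m ^ 2 := by
        gcongr
    _ = _ := by ring

variable {M}

theorem det_krylovMatrix_ne_zero (hM : ¬IsSquare M.discr) {a b : ℤ} (hab : (a, b) ≠ (0, 0)) :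
    (krylovMatrix M a b).det ≠ 0 := by
  rw [det_krylovMatrix]
  intro h
  apply hM
  have hdiscr : M.discr = (M 1 1 - M 0 0) ^ 2 + 4 * (M 0 1 * M 1 0) := by
    rw [discr_fin_two, trace_fin_two, det_fin_two]
    ring
  rcases eq_or_ne b 0 with rfl | hb
  · have ha : a ≠ 0 := by rintro rfl; exact hab rfl
    have hM01 : M 0 1 = 0 := by simpa [ha] using h
    rw [hdiscr, hM01, zero_mul, mul_zero, add_zero]
    exact IsSquare.sq _
  · rw [← Rat.isSquare_intCast_iff]
    refine ⟨(2 * M 0 1 * a + (M 1 1 - M 0 0) * b) / b, ?_⟩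
    have hsq : M.discr * (b * b) = (2 * M 0 1 * a + (M 1 1 - M 0 0) * b) *
        (2 * M 0 1 * a + (M 1 1 - M 0 0) * b) := by
      rw [hdiscr]
      linear_combination -4 * M 0 1 * h
    rw [div_mul_div_comm, eq_div_iff (mul_ne_zero (mod_cast hb) (mod_cast hb))]
    exact_mod_cast hsq

theorem norm_det_krylovMatrix_mul_le {q : Fin 2 → ℚ_[p]} (hq : q ≠ 0) {μ : ℚ_[p]}
    (hμ : padicLin p M q = μ • q) (a b : ℤ) :
    ‖((krylovMatrix M a b).det : ℚ_[p])‖ * ‖q‖ ≤ ‖intForm p a b q‖ := by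
  have hμ1 : ‖μ‖ ≤ 1 := by
    have h := norm_padicLin_le M q
    rwa [hμ, norm_smul, mul_le_iff_le_one_left (norm_pos_iff.2 hq)] at h
  have hrow0 : padicLin p (krylovMatrix M a b) q 0 = intForm p a b q := by
    simp [padicLin_apply, krylovMatrix, intForm_apply]
  have hrow1 : padicLin p (krylovMatrix M a b) q 1 = μ * intForm p a b q := by
    rw [← smul_eq_mul, ← map_smul, ← hμ]
    simp only [padicLin_apply, krylovMatrix, intForm_apply, vecMul, dotProduct, of_apply,
      cons_val', cons_val_zero, cons_val_one, cons_val_fin_one, Fin.sum_univ_two, Int.cast_add,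
      Int.cast_mul]
    ring
  refine (norm_det_mul_norm_le _ q).trans ?_
  rw [norm_eq_max, hrow0, hrow1, norm_mul]
  exact max_le le_rfl (mul_le_of_le_one_left (norm_nonneg _) hμ1)

theorem max_abs_pos {a b : ℤ} (hab : (a, b) ≠ (0, 0)) : 0 < max |(a : ℝ)| |(b : ℝ)| := by
  rw [lt_max_iff, abs_pos, abs_pos, Int.cast_ne_zero, Int.cast_ne_zero]
  simpa [imp_iff_not_or] using hab

theorem eventually_mem_PBadEps (hM : ¬IsSquare M.discr) {x : P1 p} (hx : IsEigenpoint p M x) :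
    ∀ᶠ ε in 𝓝[>] (0 : ℝ), x ∈ PBadEps p ε := by
  induction x using Projectivization.ind with | h q hq
  obtain ⟨μ, hμ⟩ := (isEigenpoint_mk_iff hq).1 hx
  set S := |(M 0 1 : ℝ)| + |(M 1 1 : ℝ) - M 0 0| + |(M 1 0 : ℝ)|
  have hS : ∀ᶠ ε in 𝓝[>] (0 : ℝ), ε * S < 1 :=
    (((continuous_mul_const S).tendsto' 0 0 (zero_mul S)).eventually_lt_const one_pos).filter_mono
      nhdsWithin_le_nhds
  filter_upwards [hS, self_mem_nhdsWithin] with ε hεS (hε : 0 < ε)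
  refine (mk_mem_PBadEps_iff hq).2 fun a b hab => ?_
  set D := (krylovMatrix M a b).det
  set m := max |(a : ℝ)| |(b : ℝ)|
  have hm : 0 < m := max_abs_pos hab
  have hD : 1 ≤ S * m ^ 2 * ‖(D : ℚ_[p])‖ :=
    (one_le_abs_mul_norm_intCast (det_krylovMatrix_ne_zero hM hab)).trans <| by
      gcongr
      exact abs_det_krylovMatrix_le M a b
  rw [div_mul_eq_mul_div, div_le_iff₀ (by positivity)]
  calc ε * ‖q‖ ≤ ε * ‖q‖ * (S * m ^ 2 * ‖(D : ℚ_[p])‖) := le_mul_of_one_le_right (by positivity) hD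
    _ = ε * S * m ^ 2 * (‖(D : ℚ_[p])‖ * ‖q‖) := by ring
    _ ≤ 1 * m ^ 2 * ‖intForm p a b q‖ := by
        gcongr
        exact norm_det_krylovMatrix_mul_le hq hμ a b
    _ = ‖intForm p a b q‖ * m ^ 2 := by ring

end Anisotropy

section PositiveMatrices

/-- The integer matrices of determinant `±1` with the sign pattern of `letterMatrix a`, `0 < a`; the
products of such letter matrices, which may have a zero only in the upper left corner, are of this
kind. -/
structure IsPositiveUnimodular (M : Matrix (Fin 2) (Fin 2) ℤ) : Prop where
  zero_zero : 0 ≤ M 0 0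
  zero_one : 0 < M 0 1
  one_zero : 0 < M 1 0
  one_one : 0 < M 1 1
  isUnit_det : IsUnit M.det

namespace IsPositiveUnimodular

variable {M M' : Matrix (Fin 2) (Fin 2) ℤ}

theorem letterMatrix {a : ℕ} (ha : 0 < a) : IsPositiveUnimodular (letterMatrix a) := by
  refine ⟨?_, ?_, ?_, ?_, by simp [det_letterMatrix]⟩ <;> simp [PLC.letterMatrix, ha]

theorem mul (h : IsPositiveUnimodular M) (h' : IsPositiveUnimodular M') :
    IsPositiveUnimodular (M * M') := by
  obtain ⟨h00, h01, h10, h11, hdet⟩ := h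
  obtain ⟨k00, k01, k10, k11, kdet⟩ := h'
  refine ⟨?_, ?_, ?_, ?_, det_mul M M' ▸ hdet.mul kdet⟩ <;>
    rw [mul_apply, Fin.sum_univ_two] <;> positivity

theorem transpose (h : IsPositiveUnimodular M) : IsPositiveUnimodular Mᵀ :=
  ⟨h.zero_zero, h.one_zero, h.zero_one, h.one_one, M.det_transpose.symm ▸ h.isUnit_det⟩

theorem pow (h : IsPositiveUnimodular M) {n : ℕ} (hn : 0 < n) : IsPositiveUnimodular (M ^ n) := by
  induction n, hn using Nat.le_induction with
  | base => simpa using h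
  | succ n _ ih => exact pow_succ M n ▸ ih.mul h

theorem pow_notMem_range_scalar (h : IsPositiveUnimodular M) {n : ℕ} (hn : 0 < n) :
    M ^ n ∉ Set.range (scalar (Fin 2)) := by
  rintro ⟨v, hv⟩
  have h01 := (h.pow hn).zero_one
  rw [← hv, scalar_apply, diagonal_apply_ne _ zero_ne_one] at h01
  exact h01.false

end IsPositiveUnimodular

-- If `t ^ 2 - 4 d` is a square, then `X ^ 2 - t X + d` has integer roots, and they are units.
theorem sq_eq_of_isSquare_sq_sub_four_mul {t d : ℤ} (hd : IsUnit d)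
    (h : IsSquare (t ^ 2 - 4 * d)) : t ^ 2 = 2 + 2 * d := by
  obtain ⟨r, hr⟩ := h
  have heven : Even (t - r) := by
    have : Even ((t - r) * (t + r)) := ⟨2 * d, by linear_combination hr⟩
    grind
  obtain ⟨x, hx⟩ := heven
  obtain rfl : t = r + (x + x) := by linear_combination hx
  have hroots : x * (r + x) = d := by linarith
  have hx1 := Int.isUnit_sq (isUnit_of_mul_isUnit_left (hroots ▸ hd))
  have hy1 := Int.isUnit_sq (isUnit_of_mul_isUnit_right (hroots ▸ hd))
  linear_combination hx1 + hy1 + 2 * hroots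

theorem IsPositiveUnimodular.not_isSquare_discr {M : Matrix (Fin 2) (Fin 2) ℤ}
    (h : IsPositiveUnimodular M) : ¬IsSquare M.discr := by
  intro hsq
  rw [discr_fin_two] at hsq
  have htr := sq_eq_of_isSquare_sq_sub_four_mul h.isUnit_det hsq
  have hdet := M.det_fin_two
  have h11 := h.one_one
  have hpos : 0 < M 0 1 * M 1 0 := mul_pos h.zero_one h.one_zero
  rw [trace_fin_two] at htr
  rcases Int.isUnit_iff.1 h.isUnit_det with hd | hd <;> rw [hd] at htr hdet
  · nlinarith [sq_nonneg (M 0 0 - M 1 1)]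
  · nlinarith [h.zero_zero]

end PositiveMatrices

section Words

theorem wordMatrix_wordPrefix_add (w : ℕ → ℕ) (m n : ℕ) :
    wordMatrix (wordPrefix w (m + n)) =
      wordMatrix (wordPrefix w m) * wordMatrix (wordPrefix (fun i => w (i + m)) n) := by
  simp only [wordMatrix, wordPrefix, List.range_add, List.map_append, List.prod_append,
    List.map_map, Function.comp_def, add_comm]

theorem wordMatrix_wordPrefix_one (w : ℕ → ℕ) :
    wordMatrix (wordPrefix w 1) = letterMatrix (w 0) := by
  simp [wordMatrix, wordPrefix]

theorem wordMatrix_wordPrefix_mul {w : ℕ → ℕ} {l : ℕ} (hw : Function.Periodic w l) (k : ℕ) :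
    wordMatrix (wordPrefix w (k * l)) = wordMatrix (wordPrefix w l) ^ k := by
  induction k with
  | zero => simp [wordMatrix, wordPrefix]
  | succ k ih =>
    rw [add_one_mul, wordMatrix_wordPrefix_add, ih, pow_succ,
      show (fun i => w (i + k * l)) = w from funext (hw.nat_mul k)]

theorem transpose_letterMatrix (a : ℕ) : (letterMatrix a)ᵀ = letterMatrix a := by
  ext i j
  fin_cases i <;> fin_cases j <;> rfl

theorem isUnit_det_wordMatrix (u : List ℕ) : IsUnit (wordMatrix u).det := by
  rw [← isUnit_iff_isUnit_det]
  refine List.prod_isUnit (List.forall_mem_map.2 fun a _ => ?_)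
  exact (isUnit_iff_isUnit_det _).2 (by simp [det_letterMatrix])

theorem IsPositiveUnimodular.wordMatrix {u : List ℕ} (hu : u ≠ []) (hpos : ∀ a ∈ u, 0 < a) :
    IsPositiveUnimodular (wordMatrix u) :=
  List.prod_induction_nonempty _ (fun _ _ => mul) (by simpa using hu)
    (List.forall_mem_map.2 fun a ha => letterMatrix (hpos a ha))

theorem words_mono {N N' : ℕ} (h : N ≤ N') : words N ⊆ words N' :=
  fun _ hw n => ⟨(hw n).1, (hw n).2.trans h⟩

theorem shift_mem_words {N : ℕ} {w : ℕ → ℕ} (hw : w ∈ words N) (r : ℕ) :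
    (fun i => w (i + r)) ∈ words N := fun n => hw (n + r)

theorem isPositiveUnimodular_transpose_wordPrefix {N : ℕ} {w : ℕ → ℕ} (hw : w ∈ words N) {l : ℕ}
    (hl : 0 < l) : IsPositiveUnimodular (wordMatrix (wordPrefix w l))ᵀ := by
  refine (IsPositiveUnimodular.wordMatrix ?_ ?_).transpose
  · simp [wordPrefix, hl.ne']
  · exact List.forall_mem_map.2 fun n _ => (hw n).1

end Words

section Dynamics

theorem iterate_T (w : ℕ → ℕ) (x : P1 p) (n : ℕ) :
    (T p)^[n] (w, x) = (fun i => w (i + n),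
      Projectivization.map (padicLin p (wordMatrix (wordPrefix w n))ᵀ)
        (padicLin_injective (isUnit_det_transpose _ (isUnit_det_wordMatrix _))) x) := by
  induction n generalizing w x with
  | zero =>
    induction x using Projectivization.ind with | h q hq
    simp [wordMatrix, wordPrefix, Projectivization.map_mk, padicLin_one]
  | succ n ih =>
    induction x using Projectivization.ind with | h q hq
    rw [Function.iterate_succ_apply, T, ih]
    simp only [Projectivization.map_mk, add_comm n 1, wordMatrix_wordPrefix_add,
      wordMatrix_wordPrefix_one, transpose_mul, transpose_letterMatrix, padicLin_mul,
      ← add_assoc, add_right_comm _ n 1]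

theorem isPeriodicPt_T_iff {w : ℕ → ℕ} {l : ℕ} (hw : Function.Periodic w l) (x : P1 p) :
    Function.IsPeriodicPt (T p) l (w, x) ↔ IsEigenpoint p (wordMatrix (wordPrefix w l))ᵀ x := by
  induction x using Projectivization.ind with | h q hq
  rw [isEigenpoint_mk_iff, Function.IsPeriodicPt, Function.IsFixedPt, iterate_T, Prod.mk.injEq,
    Projectivization.map_mk, Projectivization.mk_eq_mk_iff', and_iff_right (funext hw)]
  simp only [eq_comm]

theorem isEigenpoint_of_mem_LMad {w : ℕ → ℕ} {l : ℕ} (hl : 0 < l) (hper : Function.Periodic w l)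
    {x : P1 p} (hx : (w, x) ∈ LMad p) : IsEigenpoint p (wordMatrix (wordPrefix w l))ᵀ x := by
  obtain ⟨ε, hε, hT⟩ := hx
  have hM := isPositiveUnimodular_transpose_wordPrefix (hT 0).1 hl
  induction x using Projectivization.ind with | h q hq
  rw [isEigenpoint_mk_iff]
  by_contra! hMq
  obtain ⟨a, b, hab, hsmall⟩ := exists_intForm_padicLin_pow_lt hM.isUnit_det
    (fun m => hM.pow_notMem_range_scalar) hq hMq
  have hm := max_abs_pos hab
  obtain ⟨k, hk⟩ := hsmall (ε / (max |(a : ℝ)| |(b : ℝ)|) ^ 2 * ‖q‖) (by positivity)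
  have hbad := (hT (k * l)).2
  simp only [iterate_T, wordMatrix_wordPrefix_mul hper, transpose_pow, Projectivization.map_mk,
    mk_mem_PBadEps_iff] at hbad
  have hnorm : ‖padicLin p ((wordMatrix (wordPrefix w l))ᵀ ^ k) q‖ = ‖q‖ :=
    norm_padicLin q (by rw [det_pow]; exact hM.isUnit_det.pow k)
  exact hk.not_ge (hnorm ▸ hbad a b hab)

theorem mem_LMad_of_isEigenpoint {N : ℕ} {w : ℕ → ℕ} (hw : w ∈ words N) {l : ℕ} (hl : 0 < l)
    (hper : Function.Periodic w l) {x : P1 p}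
    (hx : IsEigenpoint p (wordMatrix (wordPrefix w l))ᵀ x) : (w, x) ∈ LMad p := by
  have hT := (isPeriodicPt_T_iff hper x).2 hx
  have hfst : ∀ n, ((T p)^[n] (w, x)).1 = fun i => w (i + n) := fun n => by rw [iterate_T]
  have hbad : ∀ r, ∀ᶠ ε in 𝓝[>] (0 : ℝ), ((T p)^[r] (w, x)).2 ∈ PBadEps p ε := fun r => by
    have hTr : Function.IsPeriodicPt (T p) l (fun i => w (i + r), ((T p)^[r] (w, x)).2) := by
      rw [← hfst r]
      exact hT.apply_iterate r
    have hpos := isPositiveUnimodular_transpose_wordPrefix (shift_mem_words hw r) hl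
    refine eventually_mem_PBadEps hpos.not_isSquare_discr ((isPeriodicPt_T_iff ?_ _).1 hTr)
    simpa only [add_comm _ r] using hper.const_add r
  have hN : ∀ᶠ ε in 𝓝[>] (0 : ℝ), N ≤ ⌊ε⁻¹⌋₊ :=
    (tendsto_nat_floor_atTop.comp tendsto_inv_nhdsGT_zero).eventually_ge_atTop N
  obtain ⟨ε, ⟨hε, hNε⟩, hbadε⟩ := ((eventually_mem_nhdsWithin.and hN).and
    ((Set.finite_Iio l).eventually_all.2 fun r _ => hbad r)).exists
  refine ⟨ε, hε, fun n => ⟨?_, ?_⟩⟩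
  · rw [hfst]
    exact words_mono (hNε.trans (Nat.le_succ _)) (shift_mem_words hw n)
  · rw [← hT.iterate_mod_apply n]
    exact hbadε _ (Nat.mod_lt n hl)

end Dynamics

section Infinite

theorem exists_sq_sub_mul_sub_one_eq_zero {a : ℤ_[p]} (ha : ‖a‖ < ‖(2 : ℤ_[p])‖ ^ 2) :
    ∃ z : ℤ_[p], z ^ 2 - a * z - 1 = 0 := by
  have h2 : ‖a‖ < ‖(2 : ℤ_[p])‖ :=
    ha.trans_le (pow_le_of_le_one (norm_nonneg _) (PadicInt.norm_le_one _) two_ne_zero)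
  have hd : ‖(2 : ℤ_[p]) - a‖ = ‖(2 : ℤ_[p])‖ := by
    rw [← norm_neg a] at h2
    rw [sub_eq_add_neg, PadicInt.norm_add_eq_max_of_ne h2.ne', max_eq_left h2.le]
  let F : Polynomial ℤ_[p] := Polynomial.X ^ 2 - Polynomial.C a * Polynomial.X - 1
  have hF : F.aeval (1 : ℤ_[p]) = -a := by simp [F]
  have hF' : F.derivative.aeval (1 : ℤ_[p]) = 2 - a := by simp [F, one_add_one_eq_two]
  obtain ⟨z, hz, -⟩ := hensels_lemma (F := F) (a := (1 : ℤ_[p])) (by rwa [hF, hF', norm_neg, hd])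
  exact ⟨z, by simpa [F] using hz⟩

theorem exists_isEigenpoint_letterMatrix {a : ℕ} (ha : ‖(a : ℤ_[p])‖ < ‖(2 : ℤ_[p])‖ ^ 2) :
    ∃ x : P1 p, IsEigenpoint p (letterMatrix a) x := by
  obtain ⟨z, hz⟩ := exists_sq_sub_mul_sub_one_eq_zero ha
  have hz' : (z : ℚ_[p]) ^ 2 - a * z - 1 = 0 := mod_cast congrArg ((↑) : ℤ_[p] → ℚ_[p]) hz
  have hv : (![1, (z : ℚ_[p])] : Fin 2 → ℚ_[p]) ≠ 0 := fun h => one_ne_zero (congrFun h 0)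
  refine ⟨Projectivization.mk ℚ_[p] _ hv, (isEigenpoint_mk_iff hv).2 ⟨z, ?_⟩⟩
  refine funext (Fin.forall_fin_two.2 ⟨?_, ?_⟩)
  · simp [padicLin_apply, letterMatrix]
  · simp only [padicLin_apply, letterMatrix, of_apply, cons_val', cons_val_zero, cons_val_one,
      cons_val_fin_one, Int.cast_one, mul_one, Int.cast_natCast, Pi.smul_apply, smul_eq_mul]
    linear_combination -hz'

theorem norm_four_mul_prime_mul_lt (c : ℕ) :
    ‖((4 * p * c : ℕ) : ℤ_[p])‖ < ‖(2 : ℤ_[p])‖ ^ 2 := by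
  have h2 : 0 < ‖(2 : ℤ_[p])‖ := norm_pos_iff.2 two_ne_zero
  have hpc : ‖((p * c : ℕ) : ℤ_[p])‖ < 1 := by
    rw [Nat.cast_mul, norm_mul]
    exact mul_lt_one_of_nonneg_of_lt_one_left (norm_nonneg _)
      (PadicInt.norm_lt_one_iff_dvd _ |>.2 dvd_rfl) (PadicInt.norm_le_one _)
  have hfour : ((4 * p * c : ℕ) : ℤ_[p]) = 2 ^ 2 * (p * c : ℕ) := by push_cast; ring
  rw [hfour, norm_mul, norm_pow]
  exact mul_lt_of_lt_one_right (by positivity) hpc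

variable (p) in
theorem infinite_LMad : (LMad p).Infinite := by
  choose x hx using fun k : ℕ =>
    exists_isEigenpoint_letterMatrix (norm_four_mul_prime_mul_lt (p := p) (k + 1))
  have hp0 := hp.out.pos
  refine Set.infinite_of_injective_forall_mem
    (f := fun k : ℕ => ((fun _ => 4 * p * (k + 1) : ℕ → ℕ), x k)) (fun k k' h => ?_) fun k => ?_
  · simpa [hp0.ne'] using congrFun (Prod.mk.inj h).1 0
  · refine mem_LMad_of_isEigenpoint (N := 4 * p * (k + 1)) (fun _ => ⟨?_, le_rfl⟩) one_pos
      (fun _ => rfl) ?_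
    · exact Nat.mul_pos (Nat.mul_pos four_pos hp0) k.succ_pos
    · rw [wordMatrix_wordPrefix_one, transpose_letterMatrix]
      exact hx k

end Infinite

end PLC

theorem theorem2p2_general (p : ℕ) [Fact p.Prime] :
    (∀ (N : ℕ) (w : ℕ → ℕ), w ∈ PLC.words N →
      ∀ l : ℕ, 0 < l → Function.Periodic w l →
        ∀ x : PLC.P1 p, (w, x) ∈ PLC.LMad p ↔
          PLC.IsEigenpoint p (PLC.wordMatrix (PLC.wordPrefix w l)).transpose x) ∧
    (PLC.LMad p).Infinite :=
  ⟨fun _ _ hw _ hl hper _ => ⟨PLC.isEigenpoint_of_mem_LMad hl hper,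
    PLC.mem_LMad_of_isEigenpoint hw hl hper⟩, PLC.infinite_LMad p⟩

theorem theorem2p2 (p : ℕ) [Fact p.Prime] :
    (∀ (N : ℕ) (w : ℕ → ℕ), w ∈ PLC.words N →
      ∀ l : ℕ, IsLeast {k : ℕ | 0 < k ∧ Function.Periodic w k} l →
        ∀ x : PLC.P1 p, (w, x) ∈ PLC.LMad p ↔
          PLC.IsEigenpoint p (PLC.wordMatrix (PLC.wordPrefix w l)).transpose x) ∧
    (PLC.LMad p).Infinite :=
  have h := theorem2p2_general p
  ⟨fun N w hw l hl => h.1 N w hw l hl.1.1 hl.1.2, h.2⟩
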